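/- For a complex polynomial $f$ of degree at least $2$, let $K_f\subset\mathbb{C}$ be the set of points whose forward orbit under $f$ is bounded (the filled-in Julia set), and let $J_f=\partial K_f$ be its Julia set. Let $f(z)=az^n+\dots$ and $g(z)=bz^m+\dots$ be complex polynomials of degrees $n,m\ge 2$ (with leading coefficients $a,b\neq 0$) having the same Julia set $J=J_f=J_g$, and suppose that $f$ is centered, i.e. the coefficient of $z^{n-1}$ in $f$ is $0$. Let $\Sigma=\{c\in\mathbb{C} : cJ=J\}$ be the group of rotational symmetries of $J$. Then $$f\circ g=\frac{b^{n-1}}{a^{m-1}}\; g\circ f\qquad\text{and}\qquad \frac{b^{n-1}}{a^{m-1}}\in\Sigma .$$ In other words, $f$ and $g$ commute under composition up to a rotational symmetry of $J$. -/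

import Mathlib

namespace PolyJulia

/-- The filled-in Julia set of `f`: the points whose forward orbit under `z ↦ f(z)` is bounded. -/
def filledJuliaSet (f : Polynomial ℂ) : Set ℂ :=
  {z | Bornology.IsBounded (Set.range fun k : ℕ => (fun w : ℂ => f.eval w)^[k] z)}

/-- The Julia set of `f`: the boundary of the filled-in Julia set. -/
def juliaSet (f : Polynomial ℂ) : Set ℂ :=
  frontier (filledJuliaSet f)

/-- A polynomial `∑ cᵢ zⁱ` of degree `d` is centered if `c_{d-1} = 0`
(only used for degree at least two). -/
def IsCentered (f : Polynomial ℂ) : Prop :=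
  f.coeff (f.natDegree - 1) = 0

/-- The group of rotational symmetries (around the origin) of the Julia set `J` of a centered
polynomial `f`, as a set of complex numbers: all `c` with `c J = J`. -/
def rotationalSymmetries (f : Polynomial ℂ) : Set ℂ :=
  {c | (fun z : ℂ => c * z) '' juliaSet f = juliaSet f}

end PolyJulia

namespace PolyJulia

open Polynomial Metric

section FiberSums

/-- Newton's identities: power sums of order less than `d` in `d` variables are determined by the
elementary symmetric functions of order less than `d`. -/
theorem aeval_psum_eq_of_aeval_esymm_eq {d : ℕ} (x y : Fin d → ℂ)
    (h : ∀ k < d, MvPolynomial.aeval x (MvPolynomial.esymm (Fin d) ℂ k) =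
      MvPolynomial.aeval y (MvPolynomial.esymm (Fin d) ℂ k)) (k : ℕ) (hk : k < d) :
    MvPolynomial.aeval x (MvPolynomial.psum (Fin d) ℂ k) =
      MvPolynomial.aeval y (MvPolynomial.psum (Fin d) ℂ k) := by
  induction k using Nat.strong_induction_on with
  | _ k ih =>
    rcases Nat.eq_zero_or_pos k with rfl | hpos
    · simp
    rw [MvPolynomial.psum_eq_mul_esymm_sub_sum _ _ k hpos]
    simp only [map_sub, map_mul, map_pow, map_neg, map_one, map_natCast, map_sum]
    rw [h k hk]
    congr 1
    refine Finset.sum_congr rfl fun a ha => ?_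
    obtain ⟨hadd, hlt⟩ := Finset.mem_filter.1 ha
    rw [Finset.HasAntidiagonal.mem_antidiagonal] at hadd
    have hpos' := hlt.1
    have hlt' := hlt.2
    rw [h a.1 (by omega), ih a.2 (by omega) (by omega)]

theorem exists_eq_prod_X_sub_C (P : ℂ[X]) :
    ∃ x : Fin P.natDegree → ℂ, P = C P.leadingCoeff * ∏ i, (X - C (x i)) := by
  have hs : P.Splits := IsAlgClosed.splits P
  have hcard : P.roots.toList.length = P.natDegree := by
    rw [Multiset.length_toList, hs.natDegree_eq_card_roots]
  refine ⟨fun i => P.roots.toList.get (i.cast hcard.symm), ?_⟩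
  conv_lhs => rw [hs.eq_prod_roots]
  congr 1
  have : (P.roots.map fun a => X - C a) =
      ((P.roots.toList.map fun a => X - C a : List ℂ[X]) : Multiset ℂ[X]) := by
    conv_lhs => rw [← Multiset.coe_toList P.roots]
    rw [Multiset.map_coe]
  rw [this, Multiset.prod_coe]
  rw [← Fin.prod_univ_fun_getElem]
  refine (Fintype.prod_equiv (finCongr hcard.symm) _ _ fun i => ?_).symm
  simp

theorem exists_sub_C_eq_prod_X_sub_C (P : ℂ[X]) (hP : 0 < P.natDegree) (w : ℂ) :
    ∃ x : Fin P.natDegree → ℂ, P - C w = C P.leadingCoeff * ∏ i, (X - C (x i)) := by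
  obtain ⟨x, hx⟩ := exists_eq_prod_X_sub_C (P - C w)
  have hd : (P - C w).natDegree = P.natDegree := natDegree_sub_C
  have hl : (P - C w).leadingCoeff = P.leadingCoeff :=
    leadingCoeff_sub_of_degree_lt (degree_C_le.trans_lt (natDegree_pos_iff_degree_pos.1 hP))
  refine ⟨fun i => x (i.cast hd.symm), ?_⟩
  conv_lhs => rw [hx, hl]
  congr 1
  exact (Fintype.prod_equiv (finCongr hd.symm) _ _ fun i => by simp).symm

theorem aeval_esymm_eq_coeff {d : ℕ} {P : ℂ[X]} {p : ℂ} (hp : p ≠ 0) {x : Fin d → ℂ}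
    (hx : P = C p * ∏ i, (X - C (x i))) {k : ℕ} (hk : k ≤ d) :
    MvPolynomial.aeval x (MvPolynomial.esymm (Fin d) ℂ k) =
      (-1) ^ k * (P.coeff (d - k) / p) := by
  have h := Multiset.prod_X_sub_C_coeff (Finset.univ.val.map x) (k := d - k) (by simp)
  simp only [Multiset.map_map, Multiset.card_map, Finset.card_val, Finset.card_univ,
    Fintype.card_fin, Nat.sub_sub_self hk] at h
  have h2 : ∏ i, (X - C (x i)) = (Multiset.map ((fun t ↦ X - C t) ∘ x) Finset.univ.val).prod := rfl
  rw [MvPolynomial.aeval_esymm_eq_multiset_esymm, hx, coeff_C_mul, h2, h,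
    mul_div_cancel_left₀ _ hp, ← mul_assoc, ← pow_add, ← two_mul]
  simp

theorem sum_eval_fiber_eq {P : ℂ[X]} (hP : 0 < P.natDegree) {w w' : ℂ}
    {x y : Fin P.natDegree → ℂ}
    (hx : P - C w = C P.leadingCoeff * ∏ i, (X - C (x i)))
    (hy : P - C w' = C P.leadingCoeff * ∏ i, (X - C (y i)))
    {H : ℂ[X]} (hH : H.natDegree < P.natDegree) :
    ∑ i, H.eval (x i) = ∑ i, H.eval (y i) := by
  have hp : P.leadingCoeff ≠ 0 := leadingCoeff_ne_zero.2 (ne_zero_of_natDegree_gt hP)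
  have key := aeval_psum_eq_of_aeval_esymm_eq x y (fun k hk => by
    rw [aeval_esymm_eq_coeff hp hx hk.le, aeval_esymm_eq_coeff hp hy hk.le]
    simp [coeff_C, show P.natDegree - k ≠ 0 by omega])
  simp only [MvPolynomial.psum, map_sum, map_pow, MvPolynomial.aeval_X] at key
  simp only [eval_eq_sum_range]
  rw [Finset.sum_comm, Finset.sum_comm (γ := Fin P.natDegree)]
  refine Finset.sum_congr rfl fun k hk => ?_
  rw [← Finset.mul_sum, ← Finset.mul_sum, key k (by rw [Finset.mem_range] at hk; omega)]

theorem prod_X_sub_C_dvd_mul_derivative {d : ℕ} (x : Fin d → ℂ) {H : ℂ[X]}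
    (hH : ∀ i, H.eval (x i) = 0) :
    ∏ i, (X - C (x i)) ∣ H * derivative (∏ i, (X - C (x i))) := by
  rw [derivative_prod_finset, Finset.mul_sum]
  refine Finset.dvd_sum fun i hi => ?_
  rw [← Finset.mul_prod_erase _ _ hi]
  simp only [derivative_sub, derivative_X, derivative_C, sub_zero, mul_one]
  exact mul_dvd_mul_right (dvd_iff_isRoot.2 (hH i)) _

/-- A polynomial of degree less than `deg P` vanishing on two fibers of `P` is zero. -/
theorem eq_zero_of_eval_eq_zero_on_two_fibers {P : ℂ[X]} (hP : 0 < P.natDegree) {w₁ w₂ : ℂ}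
    (hw : w₁ ≠ w₂) {H : ℂ[X]} (hH : H.natDegree < P.natDegree)
    (h₁ : ∀ z, P.eval z = w₁ → H.eval z = 0) (h₂ : ∀ z, P.eval z = w₂ → H.eval z = 0) :
    H = 0 := by
  have hP0 : P ≠ 0 := ne_zero_of_natDegree_gt hP
  have hdvd : ∀ w, (∀ z, P.eval z = w → H.eval z = 0) → P - C w ∣ H * derivative P := by
    intro w h
    obtain ⟨x, hx⟩ := exists_sub_C_eq_prod_X_sub_C P hP w
    have hd : derivative P = C P.leadingCoeff * derivative (∏ i, (X - C (x i))) := by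
      rw [← derivative_C_mul, ← hx]; simp
    rw [hd, hx, mul_left_comm]
    refine mul_dvd_mul_left _ (prod_X_sub_C_dvd_mul_derivative x fun i => h _ ?_)
    have := congrArg (eval (x i)) hx
    simp only [eval_sub, eval_C, eval_mul, eval_prod, eval_X] at this
    rw [Finset.prod_eq_zero (Finset.mem_univ i) (sub_self _), mul_zero] at this
    exact sub_eq_zero.1 this
  have hcop : IsCoprime (P - C w₁) (P - C w₂) := by
    refine ⟨C (w₂ - w₁)⁻¹, -C (w₂ - w₁)⁻¹, ?_⟩
    have : (C (w₂ - w₁)⁻¹ * C (w₂ - w₁) : ℂ[X]) = 1 := by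
      rw [← C_mul, inv_mul_cancel₀ (sub_ne_zero.2 hw.symm), C_1]
    rw [C_sub] at this
    linear_combination this
  have hdv := hcop.mul_dvd (hdvd w₁ h₁) (hdvd w₂ h₂)
  by_contra hH0
  have hP' : derivative P ≠ 0 := fun h => hP.ne' (derivative_eq_zero.1 h)
  have hne : ∀ w, P - C w ≠ 0 := fun w h => by
    have := congrArg natDegree h
    rw [natDegree_sub_C, natDegree_zero] at this
    omega
  have hle := natDegree_le_of_dvd hdv (mul_ne_zero hH0 hP')
  rw [natDegree_mul (hne _) (hne _), natDegree_mul hH0 hP', natDegree_sub_C, natDegree_sub_C] at hle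
  have := natDegree_derivative_lt hP.ne'
  omega

end FiberSums

section EnclosingDisc

/-- `closedBall c R` is an enclosing disc of `K` of the smallest possible radius. -/
structure IsSmallestEnclosingDisc (K : Set ℂ) (c : ℂ) (R : ℝ) : Prop where
  norm_sub_le : ∀ w ∈ K, ‖w - c‖ ≤ R
  le_radius : ∀ c' R', (∀ w ∈ K, ‖w - c'‖ ≤ R') → R ≤ R'

theorem exists_isSmallestEnclosingDisc {K : Set ℂ} (hK : Bornology.IsBounded K)
    (hne : K.Nonempty) : ∃ c R, IsSmallestEnclosingDisc K c R := by
  obtain ⟨w₀, hw₀⟩ := hne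
  obtain ⟨R₀, hR₀⟩ := hK.subset_closedBall 0
  let S : Set (ℂ × ℝ) := {q | (∀ w ∈ K, ‖w - q.1‖ ≤ q.2) ∧ q.2 ≤ R₀}
  have hclosed : IsClosed S := by
    have : S = (⋂ w ∈ K, {q : ℂ × ℝ | ‖w - q.1‖ ≤ q.2}) ∩ {q | q.2 ≤ R₀} := by
      ext q; simp [S]
    rw [this]
    refine IsClosed.inter (isClosed_biInter fun w _ => ?_) ?_
    · exact isClosed_le (by fun_prop) (by fun_prop)
    · exact isClosed_le (by fun_prop) (by fun_prop)
  have hcomp : IsCompact S := by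
    refine IsCompact.of_isClosed_subset
      ((isCompact_closedBall w₀ R₀).prod (isCompact_Icc (a := 0) (b := R₀))) hclosed ?_
    rintro ⟨c, R⟩ ⟨h1, h2⟩
    have h3 := h1 w₀ hw₀
    simp only at h2 h3
    refine ⟨?_, (norm_nonneg _).trans h3, h2⟩
    rw [mem_closedBall, dist_comm, dist_eq_norm]
    exact h3.trans h2
  have hmem : ((0 : ℂ), R₀) ∈ S := ⟨fun w hw => by simpa using hR₀ hw, le_rfl⟩
  obtain ⟨⟨c, R⟩, ⟨hcR, hR⟩, hmin⟩ :=
    hcomp.exists_isMinOn ⟨_, hmem⟩ (f := Prod.snd) continuous_snd.continuousOn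
  refine ⟨c, R, hcR, fun c' R' h => ?_⟩
  rcases le_total R' R₀ with h' | h'
  · exact hmin (show (c', R') ∈ S from ⟨h, h'⟩)
  · exact le_trans hR h'

namespace IsSmallestEnclosingDisc

variable {K : Set ℂ} {c : ℂ} {R : ℝ}

theorem radius_pos (h : IsSmallestEnclosingDisc K c R) (hK : K.Nontrivial) : 0 < R := by
  obtain ⟨x, hx, y, hy, hxy⟩ := hK
  by_contra hR
  have h1 := h.norm_sub_le x hx
  have h2 := h.norm_sub_le y hy
  have h3 : ‖x - c‖ = 0 := le_antisymm (by linarith) (norm_nonneg _)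
  have h4 : ‖y - c‖ = 0 := le_antisymm (by linarith) (norm_nonneg _)
  rw [norm_eq_zero, sub_eq_zero] at h3 h4
  exact hxy (h3.trans h4.symm)

theorem center_unique (h : IsSmallestEnclosingDisc K c R) (hK : K.Nonempty) {c' : ℂ}
    (h' : ∀ w ∈ K, ‖w - c'‖ ≤ R) : c' = c := by
  have key : ∀ w ∈ K, ‖w - (c + c') / 2‖ ^ 2 ≤ R ^ 2 - ‖c - c'‖ ^ 2 / 4 := by
    intro w hw
    have h1 := pow_le_pow_left₀ (norm_nonneg _) (h.norm_sub_le w hw) 2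
    have h2 := pow_le_pow_left₀ (norm_nonneg _) (h' w hw) 2
    have := parallelogram_law_with_norm ℝ (w - c) (w - c')
    rw [show w - c + (w - c') = 2 * (w - (c + c') / 2) by ring,
      show w - c - (w - c') = -(c - c') by ring, norm_neg, norm_mul, Complex.norm_ofNat] at this
    nlinarith
  have hR := h.le_radius _ _ fun w hw => Real.le_sqrt_of_sq_le (key w hw)
  obtain ⟨w, hw⟩ := hK
  have h0 : 0 ≤ R := (norm_nonneg _).trans (h.norm_sub_le w hw)
  have h1 := (Real.le_sqrt h0 ((sq_nonneg _).trans (key w hw))).1 hR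
  have h2 : ‖c - c'‖ = 0 := by
    have := sq_nonneg ‖c - c'‖
    exact pow_eq_zero_iff (two_ne_zero) |>.1 (by linarith)
  rw [norm_eq_zero, sub_eq_zero] at h2
  exact h2.symm

theorem exists_extremal_ne (h : IsSmallestEnclosingDisc K c R) (hK : IsCompact K)
    (hne : K.Nonempty) (hR : 0 < R) {v : ℂ} (hv : ‖v‖ = R) :
    ∃ w ∈ K, ‖w - c‖ = R ∧ w ≠ c + v := by
  by_contra! hcon
  let T : Set ℂ := K ∩ {w | inner ℝ (w - c) v ≤ R ^ 2 / 2}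
  have hT : IsCompact T := hK.inter_right (isClosed_le (by fun_prop) (by fun_prop))
  have hlt : ∀ w ∈ T, ‖w - c‖ < R := by
    rintro w ⟨hw, hw'⟩
    refine lt_of_le_of_ne (h.norm_sub_le w hw) fun heq => ?_
    have := hcon w hw heq
    subst this
    simp only [add_sub_cancel_left, real_inner_self_eq_norm_sq, hv, Set.mem_ofPred_eq] at hw'
    nlinarith
  obtain ⟨r, hr, hrT⟩ : ∃ r < R, ∀ w ∈ T, ‖w - c‖ ≤ r := by
    rcases T.eq_empty_or_nonempty with hE | hE
    · exact ⟨0, hR, by simp [hE]⟩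
    · obtain ⟨w, hw, hmax⟩ := hT.exists_isMaxOn hE
        (f := fun w => ‖w - c‖) (by fun_prop)
      exact ⟨_, hlt w hw, fun w' hw' => hmax hw'⟩
  let t : ℝ := min 1 ((R - r) / R)
  have ht0 : 0 < t := lt_min one_pos (div_pos (by linarith) hR)
  have ht1 : t ≤ 1 := min_le_left _ _
  have htR : t * R ≤ R - r := (le_div_iff₀ hR).1 (min_le_right _ _)
  have hc : c + t • v = c := h.center_unique hne fun w hw => by
    by_cases hwT : w ∈ T
    · calc ‖w - (c + t • v)‖ = ‖(w - c) - t • v‖ := by rw [sub_add_eq_sub_sub]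
        _ ≤ ‖w - c‖ + ‖t • v‖ := _root_.norm_sub_le _ _
        _ ≤ r + t * R := by
          rw [norm_smul, Real.norm_of_nonneg ht0.le, hv]
          gcongr
          exact hrT w hwT
        _ ≤ R := by linarith
    · have hin : R ^ 2 / 2 < inner ℝ (w - c) v := by
        by_contra hle
        exact hwT ⟨hw, not_lt.1 hle⟩
      refine le_of_sq_le_sq ?_ hR.le
      rw [sub_add_eq_sub_sub, norm_sub_sq_real, norm_smul, Real.norm_of_nonneg ht0.le, hv,
        real_inner_smul_right]
      have h1 := pow_le_pow_left₀ (norm_nonneg _) (h.norm_sub_le w hw) 2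
      have h2 : t * (R ^ 2 / 2) ≤ t * inner ℝ (w - c) v := by gcongr
      have h3 : t * (t * R ^ 2) ≤ 1 * (t * R ^ 2) := by gcongr
      nlinarith
  rw [add_eq_left, smul_eq_zero] at hc
  rcases hc with hc | hc
  · exact ht0.ne' hc
  · rw [hc, norm_zero] at hv
    exact hR.ne hv

theorem exists_two_extremal (h : IsSmallestEnclosingDisc K c R) (hK : IsCompact K)
    (hne : K.Nontrivial) :
    ∃ w₁ ∈ K, ∃ w₂ ∈ K, w₁ ≠ w₂ ∧ ‖w₁ - c‖ = R ∧ ‖w₂ - c‖ = R := by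
  have hR := h.radius_pos hne
  obtain ⟨w₁, hw₁, h₁, -⟩ := h.exists_extremal_ne hK hne.nonempty hR (v := (R : ℂ))
    (by simp [abs_of_pos hR])
  obtain ⟨w₂, hw₂, h₂, h₁₂⟩ := h.exists_extremal_ne hK hne.nonempty hR h₁
  exact ⟨w₁, hw₁, w₂, hw₂, fun e => h₁₂ (by rw [add_sub_cancel, e]), h₁, h₂⟩

end IsSmallestEnclosingDisc

end EnclosingDisc

section LeastDeviation

variable {K : Set ℂ} {c : ℂ} {R : ℝ} {P Q : ℂ[X]}

/-- Equality in the triangle inequality. -/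
theorem eq_of_sum_eq_of_norm_le {d : ℕ} {v : Fin d → ℂ} {s : ℂ}
    (hv : ∀ i, ‖v i‖ ≤ ‖s‖) (hsum : ∑ i, v i = d * s) (i : Fin d) : v i = s := by
  have hnn : ∀ i ∈ Finset.univ, 0 ≤ ‖s‖ ^ 2 - inner ℝ (v i) s := fun i _ => by
    have := real_inner_le_norm (v i) s
    nlinarith [hv i, norm_nonneg s]
  have hz : ∑ i, (‖s‖ ^ 2 - inner ℝ (v i) s) = 0 := by
    rw [Finset.sum_sub_distrib, ← sum_inner, hsum, ← nsmul_eq_mul,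
      ← Nat.cast_smul_eq_nsmul ℝ, real_inner_smul_left, real_inner_self_eq_norm_sq]
    simp
  have hi := (Finset.sum_eq_zero_iff_of_nonneg hnn).1 hz i (Finset.mem_univ i)
  have h1 : ‖v i - s‖ ^ 2 ≤ 0 := by
    rw [norm_sub_sq_real]
    nlinarith [hv i, norm_nonneg s, norm_nonneg (v i)]
  have h2 : ‖v i - s‖ = 0 := pow_eq_zero_iff two_ne_zero |>.1 (le_antisymm h1 (sq_nonneg _))
  exact sub_eq_zero.1 (norm_eq_zero.1 h2)

theorem natDegree_sub_leadingCoeff_mul_lt (hP : 0 < P.natDegree)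
    (hPQ : P.natDegree = Q.natDegree) (c : ℂ) :
    (C P.leadingCoeff * (Q - C c) - C Q.leadingCoeff * (P - C c)).natDegree < P.natDegree := by
  have hle : (C P.leadingCoeff * (Q - C c) - C Q.leadingCoeff * (P - C c)).natDegree
      ≤ P.natDegree := by
    refine (natDegree_sub_le _ _).trans (max_le ?_ ?_)
    · exact (natDegree_C_mul_le _ _).trans (by rw [natDegree_sub_C, hPQ])
    · exact (natDegree_C_mul_le _ _).trans (by rw [natDegree_sub_C])
  refine lt_of_le_of_ne hle fun he => ?_
  have h0 : (C P.leadingCoeff * (Q - C c) - C Q.leadingCoeff * (P - C c)).coeff P.natDegree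
      = 0 := by
    simp only [coeff_sub, coeff_C_mul, coeff_C, hP.ne', if_false, sub_zero]
    rw [coeff_natDegree, hPQ, coeff_natDegree]
    ring
  rw [← he, coeff_natDegree, leadingCoeff_eq_zero] at h0
  rw [h0, natDegree_zero] at he
  omega

/-- Averaging `Q` over the fibers of `P` gives an affine function, with constant term `S`. -/
theorem exists_fiber_sum_eq (hP : 0 < P.natDegree) (hPQ : P.natDegree = Q.natDegree)
    (hPK : ∀ z, P.eval z ∈ K ↔ z ∈ K) (hQK : ∀ z, Q.eval z ∈ K ↔ z ∈ K)
    (h : IsSmallestEnclosingDisc K c R) :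
    ∃ S : ℂ, ∀ w ∈ K, ∃ x : Fin P.natDegree → ℂ,
      (∀ z, P.eval z = w ↔ ∃ i, z = x i) ∧
      (∀ i, ‖P.leadingCoeff * (Q.eval (x i) - c)‖ ≤ ‖P.leadingCoeff‖ * R) ∧
      ∑ i, P.leadingCoeff * (Q.eval (x i) - c) =
        P.natDegree * (Q.leadingCoeff * (w - c)) + S := by
  obtain ⟨y, hy⟩ := exists_sub_C_eq_prod_X_sub_C P hP 0
  set H := C P.leadingCoeff * (Q - C c) - C Q.leadingCoeff * (P - C c) with hHdef
  have hH : H.natDegree < P.natDegree := natDegree_sub_leadingCoeff_mul_lt hP hPQ c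
  refine ⟨∑ i, H.eval (y i), fun w hw => ?_⟩
  obtain ⟨x, hx⟩ := exists_sub_C_eq_prod_X_sub_C P hP w
  have hp : P.leadingCoeff ≠ 0 := leadingCoeff_ne_zero.2 (ne_zero_of_natDegree_gt hP)
  have hroot : ∀ z, P.eval z = w ↔ ∃ i, z = x i := fun z => by
    have := congrArg (eval z) hx
    simp only [eval_sub, eval_C, eval_mul, eval_prod, eval_X] at this
    rw [← sub_eq_zero, this, mul_eq_zero, Finset.prod_eq_zero_iff]
    simp [hp, sub_eq_zero]
  have hPx : ∀ i, P.eval (x i) = w := fun i => (hroot _).2 ⟨i, rfl⟩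
  refine ⟨x, hroot, fun i => ?_, ?_⟩
  · rw [norm_mul]
    gcongr
    refine h.norm_sub_le _ ((hQK _).2 ((hPK _).1 ?_))
    rwa [hPx]
  · have hs := sum_eval_fiber_eq hP hx hy hH
    rw [← hs, hHdef]
    simp [hPx, Finset.sum_sub_distrib]

theorem exists_center_norm_le (hP : 0 < P.natDegree) (hPQ : P.natDegree = Q.natDegree) {S : ℂ}
    (hS : ∀ w ∈ K, ∃ x : Fin P.natDegree → ℂ,
      (∀ z, P.eval z = w ↔ ∃ i, z = x i) ∧
      (∀ i, ‖P.leadingCoeff * (Q.eval (x i) - c)‖ ≤ ‖P.leadingCoeff‖ * R) ∧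
      ∑ i, P.leadingCoeff * (Q.eval (x i) - c) =
        P.natDegree * (Q.leadingCoeff * (w - c)) + S) :
    ∀ w ∈ K, ‖w - (c - S / (P.natDegree * Q.leadingCoeff))‖ ≤
      ‖P.leadingCoeff‖ * R / ‖Q.leadingCoeff‖ := by
  intro w hw
  obtain ⟨x, -, hx, hsum⟩ := hS w hw
  have hq : Q.leadingCoeff ≠ 0 := leadingCoeff_ne_zero.2 (ne_zero_of_natDegree_gt (hPQ ▸ hP))
  have hd : (P.natDegree : ℂ) ≠ 0 := Nat.cast_ne_zero.2 hP.ne'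
  have hd' : (0 : ℝ) < P.natDegree := Nat.cast_pos.2 hP
  rw [le_div_iff₀ (norm_pos_iff.2 hq)]
  refine le_of_mul_le_mul_left ?_ hd'
  calc (P.natDegree : ℝ) * (‖w - (c - S / (P.natDegree * Q.leadingCoeff))‖ * ‖Q.leadingCoeff‖)
      = ‖(P.natDegree : ℂ) * (Q.leadingCoeff * (w - c)) + S‖ := by
        rw [← norm_mul, ← Complex.norm_natCast, ← norm_mul]
        congr 1
        field_simp
        ring
    _ = ‖∑ i, P.leadingCoeff * (Q.eval (x i) - c)‖ := by rw [hsum]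
    _ ≤ ∑ i : Fin P.natDegree, ‖P.leadingCoeff‖ * R :=
        norm_sum_le_of_le _ fun i _ => hx i
    _ = P.natDegree * (‖P.leadingCoeff‖ * R) := by simp

theorem norm_leadingCoeff_le (hP : 0 < P.natDegree) (hPQ : P.natDegree = Q.natDegree)
    (hPK : ∀ z, P.eval z ∈ K ↔ z ∈ K) (hQK : ∀ z, Q.eval z ∈ K ↔ z ∈ K)
    (h : IsSmallestEnclosingDisc K c R) (hR : 0 < R) :
    ‖Q.leadingCoeff‖ ≤ ‖P.leadingCoeff‖ := by
  obtain ⟨S, hS⟩ := exists_fiber_sum_eq hP hPQ hPK hQK h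
  have hq : Q.leadingCoeff ≠ 0 := leadingCoeff_ne_zero.2 (ne_zero_of_natDegree_gt (hPQ ▸ hP))
  have := h.le_radius _ _ (exists_center_norm_le hP hPQ hS)
  rw [le_div_iff₀ (norm_pos_iff.2 hq), mul_comm] at this
  exact le_of_mul_le_mul_right this hR

/-- Two polynomials of the same degree for which a compact set `K` is completely invariant are
proportional, after translating the centre of the smallest enclosing disc of `K` to the origin:
both are polynomials of least deviation on `K`. -/
theorem leadingCoeff_mul_sub_eq (hK : IsCompact K) (hne : K.Nontrivial) (hP : 0 < P.natDegree)
    (hPQ : P.natDegree = Q.natDegree)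
    (hPK : ∀ z, P.eval z ∈ K ↔ z ∈ K) (hQK : ∀ z, Q.eval z ∈ K ↔ z ∈ K)
    (h : IsSmallestEnclosingDisc K c R) :
    C P.leadingCoeff * (Q - C c) = C Q.leadingCoeff * (P - C c) := by
  have hR := h.radius_pos hne
  have hnorm : ‖P.leadingCoeff‖ = ‖Q.leadingCoeff‖ :=
    le_antisymm (norm_leadingCoeff_le (hPQ ▸ hP) hPQ.symm hQK hPK h hR)
      (norm_leadingCoeff_le hP hPQ hPK hQK h hR)
  have hq : Q.leadingCoeff ≠ 0 := leadingCoeff_ne_zero.2 (ne_zero_of_natDegree_gt (hPQ ▸ hP))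
  have hd : (P.natDegree : ℂ) ≠ 0 := Nat.cast_ne_zero.2 hP.ne'
  obtain ⟨S, hS⟩ := exists_fiber_sum_eq hP hPQ hPK hQK h
  have hc := h.center_unique hne.nonempty fun w hw => by
    have := exists_center_norm_le hP hPQ hS w hw
    rwa [hnorm, mul_div_cancel_left₀ _ (norm_ne_zero_iff.2 hq)] at this
  have hS0 : S = 0 := by
    rw [sub_eq_self, div_eq_zero_iff] at hc
    exact hc.resolve_right (mul_ne_zero hd hq)
  have hvan : ∀ w ∈ K, ‖w - c‖ = R → ∀ z, P.eval z = w →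
      (C P.leadingCoeff * (Q - C c) - C Q.leadingCoeff * (P - C c)).eval z = 0 := by
    intro w hw hwR z hz
    obtain ⟨x, hroot, hx, hsum⟩ := hS w hw
    obtain ⟨i, rfl⟩ := (hroot z).1 hz
    rw [hS0, add_zero] at hsum
    have := eq_of_sum_eq_of_norm_le (s := Q.leadingCoeff * (w - c))
      (fun i => by simpa only [norm_mul, hwR, hnorm] using hx i) hsum i
    simp [hz, this]
  obtain ⟨w₁, hw₁, w₂, hw₂, hne', h₁, h₂⟩ := h.exists_two_extremal hK hne
  exact sub_eq_zero.1 (eq_zero_of_eval_eq_zero_on_two_fibers hP hne'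
    (natDegree_sub_leadingCoeff_mul_lt hP hPQ c) (hvan w₁ hw₁ h₁) (hvan w₂ hw₂ h₂))

end LeastDeviation

section FilledJuliaSet

variable {f g : ℂ[X]}

theorem mem_filledJuliaSet_iff {z : ℂ} :
    z ∈ filledJuliaSet f ↔ ∃ B : ℝ, ∀ k : ℕ, ‖(fun w : ℂ => f.eval w)^[k] z‖ ≤ B := by
  simp [filledJuliaSet, isBounded_iff_forall_norm_le]

theorem eval_mem_filledJuliaSet_iff (z : ℂ) :
    f.eval z ∈ filledJuliaSet f ↔ z ∈ filledJuliaSet f := by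
  simp only [mem_filledJuliaSet_iff]
  constructor
  · rintro ⟨B, hB⟩
    refine ⟨max B ‖z‖, fun k => ?_⟩
    cases k with
    | zero => simp
    | succ k => exact (hB k).trans (le_max_left _ _)
  · rintro ⟨B, hB⟩
    exact ⟨B, fun k => hB (k + 1)⟩

theorem iterate_mem_filledJuliaSet_iff (k : ℕ) (z : ℂ) :
    (fun w : ℂ => f.eval w)^[k] z ∈ filledJuliaSet f ↔ z ∈ filledJuliaSet f := by
  induction k with
  | zero => simp
  | succ k ih => rw [Function.iterate_succ_apply', eval_mem_filledJuliaSet_iff, ih]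

theorem exists_escape_radius (hf : 2 ≤ f.natDegree) :
    ∃ r : ℝ, 0 < r ∧ ∀ z : ℂ, r < ‖z‖ → 2 * ‖z‖ ≤ ‖f.eval z‖ := by
  have hdeg : 0 < f.divX.degree := by
    rw [← natDegree_pos_iff_degree_pos, natDegree_divX_eq_natDegree_tsub_one]
    omega
  have ht := f.divX.tendsto_norm_atTop hdeg (tendsto_norm_cocompact_atTop (E := ℂ))
  have ht2 := ht.eventually_ge_atTop (2 + ‖f.coeff 0‖)
  rw [← Metric.cobounded_eq_cocompact, ← comap_norm_atTop, Filter.eventually_comap, Filter.eventually_atTop] at ht2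
  obtain ⟨r, hr⟩ := ht2
  refine ⟨max r 1, by positivity, fun z hz => ?_⟩
  have h1 : 1 < ‖z‖ := (le_max_right _ _).trans_lt hz
  have h2 := hr ‖z‖ ((le_max_left _ _).trans hz.le) z rfl
  have h3 : f.eval z = f.divX.eval z * z + f.coeff 0 := by
    conv_lhs => rw [← divX_mul_X_add f]
    simp
  have h4 : ‖f.divX.eval z * z‖ ≤ ‖f.eval z‖ + ‖f.coeff 0‖ := by
    rw [show f.divX.eval z * z = f.eval z - f.coeff 0 by rw [h3]; ring]
    exact norm_sub_le _ _
  rw [norm_mul] at h4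
  nlinarith [norm_nonneg (f.coeff 0)]

theorem exists_forall_norm_iterate_le (hf : 2 ≤ f.natDegree) :
    ∃ r : ℝ, ∀ z, z ∈ filledJuliaSet f ↔ ∀ k : ℕ, ‖(fun w : ℂ => f.eval w)^[k] z‖ ≤ r := by
  obtain ⟨r, hr0, hr⟩ := exists_escape_radius hf
  have hbd : ∀ z ∈ filledJuliaSet f, ‖z‖ ≤ r := by
    intro z hz
    by_contra! hlt
    have hgrow : ∀ k : ℕ, 2 ^ k * ‖z‖ ≤ ‖(fun w : ℂ => f.eval w)^[k] z‖ := by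
      intro k
      induction k with
      | zero => simp
      | succ k ih =>
        rw [Function.iterate_succ_apply', pow_succ']
        have h1 : ‖z‖ ≤ 2 ^ k * ‖z‖ :=
          le_mul_of_one_le_left (norm_nonneg _) (one_le_pow₀ one_le_two)
        have := hr _ (hlt.trans_le (h1.trans ih))
        linarith
    obtain ⟨B, hB⟩ := mem_filledJuliaSet_iff.1 hz
    obtain ⟨k, hk⟩ := pow_unbounded_of_one_lt (B / ‖z‖) (one_lt_two (α := ℝ))
    rw [div_lt_iff₀ (hr0.trans hlt)] at hk
    linarith [hgrow k, hB k]
  exact ⟨r, fun z => ⟨fun hz k => hbd _ ((iterate_mem_filledJuliaSet_iff k z).2 hz),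
    fun h => mem_filledJuliaSet_iff.2 ⟨r, h⟩⟩⟩

theorem exists_iterate_eq_eval (f : ℂ[X]) (k : ℕ) :
    ∃ p : ℂ[X], ∀ z, (fun w : ℂ => f.eval w)^[k] z = p.eval z := by
  refine ⟨f.comp^[k] X, fun z => ?_⟩
  rw [iterate_comp_eval, eval_X]

theorem isBounded_filledJuliaSet (hf : 2 ≤ f.natDegree) :
    Bornology.IsBounded (filledJuliaSet f) := by
  obtain ⟨r, hr⟩ := exists_forall_norm_iterate_le hf
  exact isBounded_iff_forall_norm_le.2 ⟨r, fun z hz => (hr z).1 hz 0⟩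

theorem isClosed_filledJuliaSet (hf : 2 ≤ f.natDegree) : IsClosed (filledJuliaSet f) := by
  obtain ⟨r, hr⟩ := exists_forall_norm_iterate_le hf
  have : filledJuliaSet f = ⋂ k : ℕ, {z | ‖(fun w : ℂ => f.eval w)^[k] z‖ ≤ r} := by
    ext z
    simp [hr z]
  rw [this]
  refine isClosed_iInter fun k => isClosed_le (Continuous.norm ?_) continuous_const
  exact f.continuous.iterate k

theorem isCompact_filledJuliaSet (hf : 2 ≤ f.natDegree) : IsCompact (filledJuliaSet f) :=
  isCompact_of_isClosed_isBounded (isClosed_filledJuliaSet hf) (isBounded_filledJuliaSet hf)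

theorem filledJuliaSet_subset_of_juliaSet_eq (hf : 2 ≤ f.natDegree) (hg : 2 ≤ g.natDegree)
    (h : juliaSet f = juliaSet g) : filledJuliaSet f ⊆ filledJuliaSet g := by
  intro z hz
  obtain ⟨r, hr⟩ := exists_forall_norm_iterate_le hg
  refine (hr z).2 fun k => ?_
  obtain ⟨p, hp⟩ := exists_iterate_eq_eval g k
  refine Complex.norm_le_of_forall_mem_frontier_norm_le (isBounded_filledJuliaSet hf)
    (f := fun w => (fun w : ℂ => g.eval w)^[k] w) ?_ (fun w hw => ?_) (subset_closure hz)
  · simp only [hp]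
    exact p.differentiable.diffContOnCl
  · change w ∈ juliaSet f at hw
    rw [h] at hw
    exact (hr w).1 ((isClosed_filledJuliaSet hg).frontier_subset hw) k

theorem filledJuliaSet_eq_of_juliaSet_eq (hf : 2 ≤ f.natDegree) (hg : 2 ≤ g.natDegree)
    (h : juliaSet f = juliaSet g) : filledJuliaSet f = filledJuliaSet g :=
  (filledJuliaSet_subset_of_juliaSet_eq hf hg h).antisymm
    (filledJuliaSet_subset_of_juliaSet_eq hg hf h.symm)

theorem exists_ne_root_or_derivative_eval_eq_zero {p : ℂ[X]} (hp : 2 ≤ p.natDegree) {z : ℂ}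
    (hz : p.eval z = 0) : (∃ w ≠ z, p.eval w = 0) ∨ p.derivative.eval z = 0 := by
  obtain ⟨q, rfl⟩ := dvd_iff_isRoot.2 (show p.IsRoot z from hz)
  have hq0 : q ≠ 0 := by
    rintro rfl
    simp at hp
  have hq : q.degree ≠ 0 := by
    rw [natDegree_mul (X_sub_C_ne_zero z) hq0, natDegree_X_sub_C] at hp
    rw [degree_eq_natDegree hq0]
    exact_mod_cast (show q.natDegree ≠ 0 by omega)
  obtain ⟨w, hw⟩ := IsAlgClosed.exists_root q hq
  by_cases h : w = z
  · right
    subst h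
    simpa using hw
  · exact Or.inl ⟨w, h, by simp [hw.eq_zero]⟩

theorem exists_eval_eq {p : ℂ[X]} (hp : 0 < p.natDegree) (w : ℂ) : ∃ z, p.eval z = w := by
  obtain ⟨z, hz⟩ := IsAlgClosed.exists_root (p - C w)
    (natDegree_pos_iff_degree_pos.1 (by rwa [natDegree_sub_C])).ne'
  refine ⟨z, ?_⟩
  have := hz.eq_zero
  rwa [eval_sub, eval_C, sub_eq_zero] at this

theorem nontrivial_filledJuliaSet (hf : 2 ≤ f.natDegree) : (filledJuliaSet f).Nontrivial := by
  have hdeg : (f - X).natDegree = f.natDegree :=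
    natDegree_sub_eq_left_of_natDegree_lt (by rw [natDegree_X]; omega)
  have hfix : ∀ z, (f - X).eval z = 0 → z ∈ filledJuliaSet f := fun z hz => by
    rw [eval_sub, eval_X, sub_eq_zero] at hz
    exact mem_filledJuliaSet_iff.2 ⟨‖z‖, fun k => by
      rw [Function.iterate_fixed (show (fun w : ℂ => f.eval w) z = z from hz)]⟩
  obtain ⟨z, hz⟩ := IsAlgClosed.exists_root (f - X)
    (natDegree_pos_iff_degree_pos.1 (by omega)).ne'
  have hzK := hfix z hz
  have hz' : f.eval z = z := by
    have := hz.eq_zero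
    rwa [eval_sub, eval_X, sub_eq_zero] at this
  rcases exists_ne_root_or_derivative_eval_eq_zero (hdeg ▸ hf) hz with ⟨w, hw, hw'⟩ | h1
  · exact ⟨w, hfix w hw', z, hzK, hw⟩
  rcases exists_ne_root_or_derivative_eval_eq_zero (p := f - C z) (by rwa [natDegree_sub_C])
    (z := z) (by simp [hz']) with ⟨w, hw, hw'⟩ | h2
  · refine ⟨w, (eval_mem_filledJuliaSet_iff w).1 ?_, z, hzK, hw⟩
    rw [eval_sub, eval_C, sub_eq_zero] at hw'
    rwa [hw']
  · simp only [derivative_sub, derivative_C, sub_zero, derivative_X, eval_sub, eval_one] at h1 h2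
    simp [h2] at h1

end FilledJuliaSet

section Centered

/-- The subleading coefficient of a centered polynomial precomposed with `z ↦ u z + e`. -/
theorem coeff_comp_linear_of_isCentered {f : ℂ[X]} (hf : 2 ≤ f.natDegree) (hc : IsCentered f)
    (u e : ℂ) :
    (f.comp (C u * X + C e)).coeff (f.natDegree - 1) =
      f.leadingCoeff * (f.natDegree * u ^ (f.natDegree - 1) * e) := by
  set n := f.natDegree with hn
  have hlow : f.eraseLead.natDegree + 2 ≤ n ∨ f.eraseLead.natDegree = 0 := by
    rcases Nat.eq_zero_or_pos f.eraseLead.natDegree with h | h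
    · exact Or.inr h
    left
    have h1 := f.eraseLead_natDegree_le
    have h2 : f.eraseLead.natDegree ≠ n - 1 := fun h2 => by
      have : f.eraseLead.coeff (n - 1) = 0 := by
        rw [eraseLead_coeff_of_ne _ (by omega)]
        exact hc
      rw [← h2, coeff_natDegree, leadingCoeff_eq_zero] at this
      rw [this, natDegree_zero] at h
      omega
    omega
  have hlin : (C u * X + C e).natDegree ≤ 1 := natDegree_linear_le
  conv_lhs => rw [← f.eraseLead_add_C_mul_X_pow]
  rw [add_comp, coeff_add, coeff_eq_zero_of_natDegree_lt (p := f.eraseLead.comp _), zero_add,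
    mul_comp, C_comp, X_pow_comp, coeff_C_mul, ← hn]
  · congr 1
    obtain ⟨k, hk⟩ : ∃ k, n = k + 1 := ⟨n - 1, by omega⟩
    have hterm : ∀ b, (C u * X) ^ b * C e ^ (k + 1 - b) * ((k + 1).choose b : ℂ[X]) =
        C (u ^ b * e ^ (k + 1 - b) * (k + 1).choose b) * X ^ b := fun b => by
      simp only [C_mul, C_pow, map_natCast]
      ring
    simp_rw [hk, Nat.add_sub_cancel, add_pow, hterm, finsetSum_coeff, coeff_C_mul_X_pow]
    rw [Finset.sum_ite_eq, if_pos (by simp), Nat.choose_succ_self_right]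
    simp
    ring
  · refine natDegree_comp_le.trans_lt ((Nat.mul_le_mul_left _ hlin).trans_lt ?_)
    omega

end Centered

end PolyJulia

open Polynomial PolyJulia in
theorem comp_eq_C_mul_comp_of_filledJuliaSet_eq {f g : ℂ[X]} (hf : 2 ≤ f.natDegree)
    (hg : 2 ≤ g.natDegree) (hc : IsCentered f) (hK : filledJuliaSet f = filledJuliaSet g) :
    f.comp g = C (g.leadingCoeff ^ (f.natDegree - 1) / f.leadingCoeff ^ (g.natDegree - 1)) *
      g.comp f := by
  have ha : f.leadingCoeff ≠ 0 := leadingCoeff_ne_zero.2 (ne_zero_of_natDegree_gt hf)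
  have hb : g.leadingCoeff ≠ 0 := leadingCoeff_ne_zero.2 (ne_zero_of_natDegree_gt hg)
  have hfK := eval_mem_filledJuliaSet_iff (f := f)
  have hgK := eval_mem_filledJuliaSet_iff (f := g)
  rw [← hK] at hgK
  have hcpt := isCompact_filledJuliaSet hf
  have hnt := nontrivial_filledJuliaSet hf
  obtain ⟨c, R, hcR⟩ := exists_isSmallestEnclosingDisc hcpt.isBounded hnt.nonempty
  set u := g.leadingCoeff ^ (f.natDegree - 1) / f.leadingCoeff ^ (g.natDegree - 1) with hu
  have hu0 : u ≠ 0 := div_ne_zero (pow_ne_zero _ hb) (pow_ne_zero _ ha)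
  have hlead : (f.comp g).leadingCoeff = u * (g.comp f).leadingCoeff := by
    rw [leadingCoeff_comp (by omega), leadingCoeff_comp (by omega), hu]
    obtain ⟨k, hk⟩ : ∃ k, f.natDegree = k + 1 := ⟨f.natDegree - 1, by omega⟩
    obtain ⟨l, hl⟩ : ∃ l, g.natDegree = l + 1 := ⟨g.natDegree - 1, by omega⟩
    rw [hk, hl, Nat.add_sub_cancel, Nat.add_sub_cancel]
    field_simp
    ring
  have hgf0 : (g.comp f).leadingCoeff ≠ 0 := by
    rw [leadingCoeff_comp (by omega)]
    exact mul_ne_zero hb (pow_ne_zero _ ha)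
  have hfg : f.comp g = C u * g.comp f + C ((1 - u) * c) := by
    have h1 := leadingCoeff_mul_sub_eq (P := g.comp f) (Q := f.comp g) hcpt hnt
      (by rw [natDegree_comp]; positivity) (by rw [natDegree_comp, natDegree_comp, mul_comm])
      (fun z => by rw [eval_comp, hgK, hfK]) (fun z => by rw [eval_comp, hfK, hgK]) hcR
    rw [hlead, C_mul, mul_comm (C u), mul_assoc] at h1
    have h2 := mul_left_cancel₀ (C_ne_zero.2 hgf0) h1
    rw [C_mul, C_sub, C_1]
    linear_combination h2
  have hrot : ∀ w, u * w + (1 - u) * c ∈ filledJuliaSet f ↔ w ∈ filledJuliaSet f := fun w => by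
    obtain ⟨z, rfl⟩ : ∃ z, (g.comp f).eval z = w :=
      exists_eval_eq (p := g.comp f) (by rw [natDegree_comp]; positivity) w
    have h1 := congrArg (eval z) hfg
    simp only [eval_add, eval_mul, eval_C] at h1
    rw [← h1, eval_comp, eval_comp, hfK, hgK, hgK, hfK]
  have he : (1 - u) * c = 0 := by
    have hlin : (C u * X + C ((1 - u) * c)).natDegree = 1 := natDegree_linear hu0
    have hd : (f.comp (C u * X + C ((1 - u) * c))).natDegree = f.natDegree := by
      rw [natDegree_comp, hlin, mul_one]
    have h1 := leadingCoeff_mul_sub_eq (P := f) (Q := f.comp (C u * X + C ((1 - u) * c))) hcpt hnt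
      (by omega) hd.symm hfK (fun z => by
        rw [eval_comp, hfK]
        simpa using hrot z) hcR
    have h2 := congrArg (fun p => p.coeff (f.natDegree - 1)) h1
    simp only [coeff_C_mul, coeff_sub, coeff_C, show f.natDegree - 1 ≠ 0 by omega, if_false,
      sub_zero, coeff_comp_linear_of_isCentered hf hc, show f.coeff (f.natDegree - 1) = 0 from hc,
      mul_zero] at h2
    have hn : (f.natDegree : ℂ) ≠ 0 := Nat.cast_ne_zero.2 (by omega)
    simpa [ha, hn, hu0] using h2
  rw [hfg, he, C_0, add_zero]

open Polynomial PolyJulia in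
theorem mem_rotationalSymmetries_of_comp_eq_C_mul_comp {f g : ℂ[X]} (hf : 2 ≤ f.natDegree)
    (hg : 2 ≤ g.natDegree) (hK : filledJuliaSet f = filledJuliaSet g) {u : ℂ} (hu : u ≠ 0)
    (h : f.comp g = C u * g.comp f) : u ∈ rotationalSymmetries f := by
  have hfK := eval_mem_filledJuliaSet_iff (f := f)
  have hgK := eval_mem_filledJuliaSet_iff (f := g)
  rw [← hK] at hgK
  have hrot : ∀ w, u * w ∈ filledJuliaSet f ↔ w ∈ filledJuliaSet f := fun w => by
    obtain ⟨z, rfl⟩ : ∃ z, (g.comp f).eval z = w :=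
      exists_eval_eq (p := g.comp f) (by rw [natDegree_comp]; positivity) w
    have h1 := congrArg (eval z) h
    simp only [eval_mul, eval_C] at h1
    rw [← h1, eval_comp, eval_comp, hfK, hgK, hgK, hfK]
  change Homeomorph.mulLeft₀ u hu '' frontier _ = frontier _
  rw [Homeomorph.image_frontier]
  congr 1
  ext w
  constructor
  · rintro ⟨z, hz, rfl⟩
    exact (hrot z).2 hz
  · intro hw
    refine ⟨u⁻¹ * w, (hrot _).1 ?_, ?_⟩ <;> simp [mul_inv_cancel_left₀ hu, hw]

theorem proposition8 (f g : Polynomial ℂ) (n m : ℕ) (a b : ℂ)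
    (hn : 2 ≤ n) (hm : 2 ≤ m)
    (hfn : f.natDegree = n) (hgm : g.natDegree = m)
    (ha : f.leadingCoeff = a) (hb : g.leadingCoeff = b)
    (hf : PolyJulia.IsCentered f)
    (hJ : PolyJulia.juliaSet f = PolyJulia.juliaSet g) :
    f.comp g = Polynomial.C (b ^ (n - 1) / a ^ (m - 1)) * g.comp f ∧
      b ^ (n - 1) / a ^ (m - 1) ∈ PolyJulia.rotationalSymmetries f := by
  subst hfn hgm ha hb
  have hK := PolyJulia.filledJuliaSet_eq_of_juliaSet_eq hn hm hJ
  have h := comp_eq_C_mul_comp_of_filledJuliaSet_eq hn hm hf hK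
  refine ⟨h, mem_rotationalSymmetries_of_comp_eq_C_mul_comp hn hm hK (div_ne_zero ?_ ?_) h⟩
  · exact pow_ne_zero _ (Polynomial.leadingCoeff_ne_zero.2 (Polynomial.ne_zero_of_natDegree_gt hm))
  · exact pow_ne_zero _ (Polynomial.leadingCoeff_ne_zero.2 (Polynomial.ne_zero_of_natDegree_gt hn))
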